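/- **Model.** A team has $N$ agents. The state space $\mathcal S$ is a topological space with its Borel $\sigma$-algebra. The joint-observation space is $\mathcal O=\prod_{n=0}^{N}\mathcal O^{(n)}$ with all $\mathcal O^{(n)}$ countable and discrete; at each time, agent $n$ sees only the common observation in $\mathcal O^{(0)}$ and her private observation in $\mathcal O^{(n)}$. The joint-action space is $\mathcal A=\prod_{n=1}^{N}\mathcal A^{(n)}$ with all $\mathcal A^{(n)}$ finite and discrete. Let $P_1$ be a probability measure on $\mathcal S\times\mathcal O$ (law of the initial state and joint observation) and let $P$ be a Markov transition kernel from $\mathcal S\times\mathcal A$ to $\mathcal S\times\mathcal O$: given the past, the next state and joint observation $(S_{t+1},O_{t+1})$ have law $P(S_t,A_t,\cdot)$. **Histories.** The joint history at time $t$ is $H_t=(O_{1:t},A_{1:t-1})$, with values in $\mathcal H_t=\mathcal O^{t}\times\mathcal A^{t-1}$; agent $n$ knows the part $H_t^{(0,n)}=(O^{(0)}_{1:t},O^{(n)}_{1:t},A^{(n)}_{1:t-1})$, with values in $\mathcal H_t^{(0,n)}$. **Policy-profiles.** For a topological space $X$, let $M_1(X)$ denote the set of Borel probability measures on $X$, with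 the topology of weak convergence. A decentralized behavioral policy-profile is a family $u=(u^{(n)}_t)_{1\le n\le N,\,t\ge1}$ of maps $u^{(n)}_t:\mathcal H_t^{(0,n)}\to M_1(\mathcal A^{(n)})$. Let $\mathcal U$ be the set of all of them, with the product topology of $\prod_{n,t,h}M_1(\mathcal A^{(n)})$, the product being over all $n$, $t$ and $h\in\mathcal H_t^{(0,n)}$. A profile is pure if every $u^{(n)}_t(h)$ is a Dirac measure; $\mathcal U_{\mathrm{pure}}\subseteq\mathcal U$ is the subspace of pure profiles. Under $u$, given the past and $H_t=h_t$, the agents act independently of each other, and the joint action $a_t$ has probability $\prod_{n=1}^N u^{(n)}_t(h^{(0,n)}_t)(a_t^{(n)})$. With $P_1$ and $P$ this determines a unique probability measure $\mathbb P^u$ on the trajectories $(S_t,O_t,A_t)_{t\ge1}$. An element $\mu\in M_1(\mathcal U)$ is a joint mixture: a profile $U$ is drawn from $\mu$, and then the trajectory is drawn from $\mathbb P^{U}$; let $\mathbb P^{\mu}$ be the resulting joint law on $\mathcal U\times(\mathcal S\times\mathcal O\times\mathcal A)^{\infty}$. By push-forward along the inclusion, $M_1(\mathcal U_{\mathrm{pure}})$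 is regarded as a subset of $M_1(\mathcal U)$. **Occupation measures.** The (undiscounted, infinite-horizon) occupation measure of $\mu\in M_1(\mathcal U)$ is the family $$\mathrm{Occ}(\mu)=\bigl(\mathbb P^{\mu}(H_t=h_t,\,A_t=a_t)\bigr)_{t\ge1,\;h_t\in\mathcal H_t,\;a_t\in\mathcal A}.$$ **Theorem.** Joint mixtures of decentralized behavioral policy-profiles and joint mixtures of decentralized pure policy-profiles achieve exactly the same occupation measures: $$\{\mathrm{Occ}(\mu):\mu\in M_1(\mathcal U)\}=\{\mathrm{Occ}(\mu):\mu\in M_1(\mathcal U_{\mathrm{pure}})\}.$$ -/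

import Mathlib

open MeasureTheory ProbabilityTheory

namespace DecTeam

noncomputable section

/-! ### Observations, actions, histories

There are `N` agents, numbered by `Fin N`. `O 0` is the common-observation space of the team and
`O n.succ` the private-observation space of agent `n`; `A n` is the action space of agent `n`.
Times are counted from `0`: the index `t : ℕ` stands for the `(t + 1)`-st time-step. -/

/-- The joint-observation space. -/
abbrev JointObs {N : ℕ} (O : Fin (N + 1) → Type*) := ∀ i, O i

/-- The joint-action space. -/
abbrev JointAct {N : ℕ} (A : Fin N → Type*) := ∀ n, A n

/-- What happens in one time-step: a state, a joint observation and a joint action. -/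
abbrev Step {N : ℕ} (S : Type*) (O : Fin (N + 1) → Type*) (A : Fin N → Type*) :=
  (S × JointObs O) × JointAct A

/-- Joint histories available at time `t`: all joint observations up to and including time `t`
and all joint actions before time `t`. -/
abbrev JointHist {N : ℕ} (O : Fin (N + 1) → Type*) (A : Fin N → Type*) (t : ℕ) :=
  (Fin (t + 1) → JointObs O) × (Fin t → JointAct A)

/-- Histories of agent `n` at time `t`: the common observations and her private observations up to
and including time `t`, and her own actions before time `t`. -/
abbrev AgentHist {N : ℕ} (O : Fin (N + 1) → Type*) (A : Fin N → Type*) (n : Fin N) (t : ℕ) :=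
  ((Fin (t + 1) → O 0) × (Fin (t + 1) → O n.succ)) × (Fin t → A n)

section

variable {N : ℕ} {S : Type*} {O : Fin (N + 1) → Type*} {A : Fin N → Type*}

/-- The part of a joint history that agent `n` knows. -/
def agentHist {t : ℕ} (h : JointHist O A t) (n : Fin N) : AgentHist O A n t :=
  ((fun i => h.1 i 0, fun i => h.1 i n.succ), fun i => h.2 i n)

/-- The joint history at time `t` along a trajectory. -/
def trajHist (t : ℕ) (ω : ℕ → Step S O A) : JointHist O A t :=
  (fun i => (ω i).1.2, fun i => (ω i).2)

/-- The joint history at time `t + 1`, from the trajectory up to time `t` and the joint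
observation `o` at time `t + 1`. -/
def nextHist (t : ℕ) (x : Finset.Iic t → Step S O A) (o : JointObs O) : JointHist O A (t + 1) :=
  (Fin.snoc (α := fun _ => JointObs O)
      (fun i : Fin (t + 1) => (x ⟨i, Finset.mem_Iic.2 (Nat.lt_succ_iff.1 i.2)⟩).1.2) o,
    fun i : Fin (t + 1) => (x ⟨i, Finset.mem_Iic.2 (Nat.lt_succ_iff.1 i.2)⟩).2)

end

/-! ### Decentralized policy-profiles -/

/-- Decentralized behavioral policy-profiles: a decision rule of agent `n` at time `t` maps her
histories to probability measures on her action space. -/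
def PolicyProfile {N : ℕ} (O : Fin (N + 1) → Type*) (A : Fin N → Type*)
    [∀ n, MeasurableSpace (A n)] :=
  ∀ (n : Fin N) (t : ℕ), AgentHist O A n t → ProbabilityMeasure (A n)

section

variable {N : ℕ} {S : Type*} [MeasurableSpace S]
  {O : Fin (N + 1) → Type*} [∀ i, MeasurableSpace (O i)]
  {A : Fin N → Type*} [∀ n, MeasurableSpace (A n)]

/-- The product topology, each factor carrying the topology of weak convergence. -/
instance [∀ n, TopologicalSpace (A n)] [∀ n, OpensMeasurableSpace (A n)] :
    TopologicalSpace (PolicyProfile O A) :=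
  inferInstanceAs
    (TopologicalSpace (∀ (n : Fin N) (t : ℕ), AgentHist O A n t → ProbabilityMeasure (A n)))

instance [∀ n, TopologicalSpace (A n)] [∀ n, OpensMeasurableSpace (A n)] :
    MeasurableSpace (PolicyProfile O A) :=
  borel (PolicyProfile O A)

instance [∀ n, TopologicalSpace (A n)] [∀ n, OpensMeasurableSpace (A n)] :
    BorelSpace (PolicyProfile O A) :=
  ⟨rfl⟩

/-- A policy-profile is pure if every agent chooses her action deterministically after each of
her histories. -/
def PolicyProfile.IsPure (u : PolicyProfile O A) : Prop :=
  ∀ (n : Fin N) (t : ℕ) (h : AgentHist O A n t),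
    ∃ a : A n, (u n t h : Measure (A n)) = Measure.dirac a

/-- The set of decentralized pure policy-profiles. -/
def pureProfiles (O : Fin (N + 1) → Type*) (A : Fin N → Type*) [∀ n, MeasurableSpace (A n)] :
    Set (PolicyProfile O A) :=
  {u | u.IsPure}

/-- The law of the joint action after a joint history: the agents randomize independently. -/
def jointActLaw {t : ℕ} (u : PolicyProfile O A) (h : JointHist O A t) : Measure (JointAct A) :=
  Measure.pi fun n => (u n t (agentHist h n) : Measure (A n))

instance {t : ℕ} (u : PolicyProfile O A) (h : JointHist O A t) :
    IsProbabilityMeasure (jointActLaw u h) := by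
  unfold jointActLaw; infer_instance

lemma measurable_nextHist (t : ℕ) :
    Measurable fun p : (Finset.Iic t → Step S O A) × JointObs O => nextHist t p.1 p.2 := by
  unfold nextHist
  refine Measurable.prodMk (measurable_pi_lambda _ fun i => ?_) (by fun_prop)
  refine Fin.lastCases ?_ (fun j => ?_) i
  · simpa using measurable_snd
  · simp only [Fin.snoc_castSucc]
    fun_prop

end

/-! ### The law of the trajectory -/

section

variable {N : ℕ} {S : Type*} [MeasurableSpace S]
  {O : Fin (N + 1) → Type*} [∀ i, MeasurableSpace (O i)]
  [∀ i, Countable (O i)] [∀ i, MeasurableSingletonClass (O i)]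
  {A : Fin N → Type*} [∀ n, Finite (A n)]
  [∀ n, TopologicalSpace (A n)] [∀ n, DiscreteTopology (A n)]
  [∀ n, MeasurableSpace (A n)] [∀ n, BorelSpace (A n)]

lemma measurable_profile_apply (n : Fin N) (t : ℕ) (h : AgentHist O A n t) (s : Set (A n)) :
    Measurable fun u : PolicyProfile O A => (u n t h : Measure (A n)) s := by
  have hc : Continuous fun u : PolicyProfile O A => u n t h :=
    show Continuous fun u : (∀ (n : Fin N) (t : ℕ), AgentHist O A n t → ProbabilityMeasure (A n)) =>
      u n t h by fun_prop
  refine Continuous.measurable (continuous_iff_continuousAt.2 fun u => ?_)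
  refine ProbabilityMeasure.tendsto_measure_of_null_frontier_of_tendsto' hc.continuousAt ?_
  simp

lemma measurable_jointActLaw (t : ℕ) :
    Measurable fun p : PolicyProfile O A × JointHist O A t => jointActLaw p.1 p.2 := by
  refine measurable_from_prod_countable_left fun h => ?_
  refine Measurable.measure_of_isPiSystem_of_isProbabilityMeasure
    generateFrom_pi.symm isPiSystem_pi ?_
  rintro _ ⟨s, -, rfl⟩
  simp only [jointActLaw, Measure.pi_pi]
  exact Finset.measurable_prod _ fun n _ => measurable_profile_apply n t _ (s n)

/-- `jointActLaw`, as a kernel. -/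
def actKernel (O : Fin (N + 1) → Type*) [∀ i, MeasurableSpace (O i)]
    [∀ i, Countable (O i)] [∀ i, MeasurableSingletonClass (O i)]
    (A : Fin N → Type*) [∀ n, Finite (A n)]
    [∀ n, TopologicalSpace (A n)] [∀ n, DiscreteTopology (A n)]
    [∀ n, MeasurableSpace (A n)] [∀ n, BorelSpace (A n)] (t : ℕ) :
    Kernel (PolicyProfile O A × JointHist O A t) (JointAct A) where
  toFun p := jointActLaw p.1 p.2
  measurable' := measurable_jointActLaw t

instance (t : ℕ) : IsMarkovKernel (actKernel O A t) :=
  ⟨fun p => inferInstanceAs (IsProbabilityMeasure (jointActLaw p.1 p.2))⟩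

/-- The law of the first time-step under a policy-profile: the state and the joint observation are
drawn from `P₁`, then the agents act knowing the joint observation. -/
def initKernel (P₁ : Measure (S × JointObs O)) :
    Kernel (PolicyProfile O A) (Step S O A) :=
  Kernel.const (PolicyProfile O A) P₁ ⊗ₖ
    (actKernel O A 0).comap
      (fun p : PolicyProfile O A × (S × JointObs O) => (p.1, (fun _ => p.2.2, Fin.elim0)))
      (by fun_prop)

instance (P₁ : Measure (S × JointObs O)) [IsProbabilityMeasure P₁] :
    IsMarkovKernel (initKernel (A := A) P₁) := by
  unfold initKernel; infer_instance

/-- The law of time-step `t + 1` given the policy-profile and the trajectory up to time `t`: the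
next state and joint observation follow the transition law `Ptr`, which depends on the current
state and joint action only; then the agents act according to their updated histories. -/
def stepKernel (Ptr : Kernel (S × JointAct A) (S × JointObs O)) (t : ℕ) :
    Kernel (PolicyProfile O A × (Finset.Iic t → Step S O A)) (Step S O A) :=
  Ptr.comap (fun p : PolicyProfile O A × (Finset.Iic t → Step S O A) =>
      ((p.2 ⟨t, Finset.mem_Iic.2 le_rfl⟩).1.1, (p.2 ⟨t, Finset.mem_Iic.2 le_rfl⟩).2))
      (by fun_prop) ⊗ₖ
    (actKernel O A (t + 1)).comap
      (fun q : (PolicyProfile O A × (Finset.Iic t → Step S O A)) × (S × JointObs O) =>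
        (q.1.1, nextHist t q.1.2 q.2.2))
      (measurable_fst.fst.prodMk
        ((measurable_nextHist t).comp (measurable_fst.snd.prodMk measurable_snd.snd)))

instance (Ptr : Kernel (S × JointAct A) (S × JointObs O)) [IsMarkovKernel Ptr] (t : ℕ) :
    IsMarkovKernel (stepKernel Ptr t) := by
  unfold stepKernel; infer_instance

/-- The law on trajectories that a policy-profile induces (by the Ionescu-Tulcea theorem). -/
def profileLaw (Ptr : Kernel (S × JointAct A) (S × JointObs O)) [IsMarkovKernel Ptr]
    (P₁ : Measure (S × JointObs O)) (u : PolicyProfile O A) : Measure (ℕ → Step S O A) :=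
  Kernel.trajMeasure (X := fun _ => Step S O A) (initKernel P₁ u)
    fun t => (stepKernel Ptr t).sectR u

instance (Ptr : Kernel (S × JointAct A) (S × JointObs O)) [IsMarkovKernel Ptr]
    (P₁ : Measure (S × JointObs O)) [IsProbabilityMeasure P₁] (u : PolicyProfile O A) :
    IsProbabilityMeasure (profileLaw Ptr P₁ u) := by
  unfold profileLaw; infer_instance

lemma measurable_profileLaw_map (Ptr : Kernel (S × JointAct A) (S × JointObs O)) [IsMarkovKernel Ptr]
    (P₁ : Measure (S × JointObs O)) [IsProbabilityMeasure P₁] (t : ℕ) :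
    Measurable fun u : PolicyProfile O A =>
      (profileLaw Ptr P₁ u).map (Preorder.frestrictLe (π := fun _ => Step S O A) t) := by
  induction t with
  | zero =>
    have h0 (u : PolicyProfile O A) :
        (profileLaw Ptr P₁ u).map (Preorder.frestrictLe (π := fun _ => Step S O A) 0) =
          (initKernel P₁ u).map
            (MeasurableEquiv.piUnique (fun _ : Finset.Iic 0 => Step S O A)).symm := by
      rw [profileLaw, Kernel.trajMeasure, Measure.map_comp _ _ (by fun_prop),
        Kernel.traj_map_frestrictLe, Kernel.partialTraj_self, Measure.id_comp]
    simp only [h0]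
    exact (Measure.measurable_map _ (MeasurableEquiv.measurable _)).comp (initKernel P₁).measurable
  | succ t ih =>
    let glue : (Finset.Iic t → Step S O A) × Step S O A → (Finset.Iic (t + 1) → Step S O A) :=
      fun p i => if h : (i : ℕ) ≤ t then p.1 ⟨i, Finset.mem_Iic.2 h⟩ else p.2
    have hglue : Measurable glue := by
      refine measurable_pi_lambda _ fun i => ?_
      by_cases h : (i : ℕ) ≤ t
      · simp only [glue, h, dite_true]; fun_prop
      · simp only [glue, h, dite_false]; fun_prop
    let ν : Kernel (PolicyProfile O A) (Finset.Iic t → Step S O A) :=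
      ⟨fun u => (profileLaw Ptr P₁ u).map (Preorder.frestrictLe (π := fun _ => Step S O A) t), ih⟩
    have : IsMarkovKernel ν := ⟨fun u => Measure.isProbabilityMeasure_map (by fun_prop)⟩
    have h1 (u : PolicyProfile O A) :
        (profileLaw Ptr P₁ u).map (Preorder.frestrictLe (π := fun _ => Step S O A) (t + 1)) =
          ((ν ⊗ₖ stepKernel Ptr t) u).map glue := by
      rw [Kernel.compProd_apply_eq_compProd_sectR]
      change _ = ((profileLaw Ptr P₁ u).map (Preorder.frestrictLe (π := fun _ => Step S O A) t) ⊗ₘ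
        (stepKernel Ptr t).sectR u).map glue
      have h2 := Kernel.map_frestrictLe_trajMeasure_compProd_eq_map_trajMeasure
        (X := fun _ => Step S O A) (μ₀ := initKernel P₁ u)
        (κ := fun t => (stepKernel Ptr t).sectR u) (a := t)
      rw [profileLaw, h2, Measure.map_map hglue (by fun_prop)]
      congr 1
      funext x i
      by_cases h : (i : ℕ) ≤ t
      · simp [glue, h]
      · have : (i : ℕ) = t + 1 := by have := Finset.mem_Iic.1 i.2; omega
        simp [glue, this]
    simp only [h1]
    exact (Measure.measurable_map _ hglue).comp (ν ⊗ₖ stepKernel Ptr t).measurable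

lemma measurable_profileLaw (Ptr : Kernel (S × JointAct A) (S × JointObs O)) [IsMarkovKernel Ptr]
    (P₁ : Measure (S × JointObs O)) [IsProbabilityMeasure P₁] :
    Measurable fun u : PolicyProfile O A => profileLaw Ptr P₁ u := by
  refine Measurable.measure_of_isPiSystem_of_isProbabilityMeasure
    (generateFrom_measurableCylinders (α := fun _ : ℕ => Step S O A)).symm
    isPiSystem_measurableCylinders ?_
  intro E hE
  obtain ⟨I, B, mB, rfl⟩ := (mem_measurableCylinders _).1 hE
  have hI : I ⊆ Finset.Iic (I.sup id) := fun i hi => Finset.mem_Iic.2 (Finset.le_sup (f := id) hi)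
  have h1 (u : PolicyProfile O A) : profileLaw Ptr P₁ u (cylinder I B) =
      (profileLaw Ptr P₁ u).map (Preorder.frestrictLe (π := fun _ => Step S O A) (I.sup id))
        (Finset.restrict₂ (π := fun _ => Step S O A) hI ⁻¹' B) := by
    rw [Measure.map_apply (by fun_prop) (mB.preimage (Finset.measurable_restrict₂ _))]
    rfl
  simp only [h1]
  exact (Measure.measurable_coe (mB.preimage (Finset.measurable_restrict₂ _))).comp
    (measurable_profileLaw_map Ptr P₁ _)

/-- `profileLaw`, as a kernel. -/
def profileKernel (Ptr : Kernel (S × JointAct A) (S × JointObs O)) [IsMarkovKernel Ptr]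
    (P₁ : Measure (S × JointObs O)) [IsProbabilityMeasure P₁] :
    Kernel (PolicyProfile O A) (ℕ → Step S O A) where
  toFun := profileLaw Ptr P₁
  measurable' := measurable_profileLaw Ptr P₁

/-- The law on policy-profiles and trajectories that a joint mixture `μ` induces: first the
policy-profile is drawn from `μ`, then the trajectory evolves under it. -/
def mixtureLaw (Ptr : Kernel (S × JointAct A) (S × JointObs O)) [IsMarkovKernel Ptr]
    (P₁ : Measure (S × JointObs O)) [IsProbabilityMeasure P₁]
    (μ : ProbabilityMeasure (PolicyProfile O A)) :
    Measure (PolicyProfile O A × (ℕ → Step S O A)) :=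
  (μ : Measure (PolicyProfile O A)) ⊗ₘ profileKernel Ptr P₁

/-- The occupation measure of a joint mixture, for time-horizon `T` and discount factor `α`: the
family of the discounted probabilities of all pairs of a joint history and a joint action. -/
def occupationMeasure (Ptr : Kernel (S × JointAct A) (S × JointObs O)) [IsMarkovKernel Ptr]
    (P₁ : Measure (S × JointObs O)) [IsProbabilityMeasure P₁] (T : ℕ∞) (α : ℝ)
    (μ : ProbabilityMeasure (PolicyProfile O A)) :
    (Σ t : {t : ℕ // (t : ℕ∞) < T}, JointHist O A t × JointAct A) → ℝ :=
  fun p => α ^ (p.1 : ℕ) *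
    (mixtureLaw Ptr P₁ μ).real {x | trajHist p.1 x.2 = p.2.1 ∧ (x.2 p.1).2 = p.2.2}

/-- The joint mixtures of decentralized pure policy-profiles, that is, the probability measures on
the subspace of pure policy-profiles, regarded as probability measures on all policy-profiles. -/
def pureMixtures (O : Fin (N + 1) → Type*) (A : Fin N → Type*)
    [∀ n, TopologicalSpace (A n)] [∀ n, MeasurableSpace (A n)] [∀ n, BorelSpace (A n)] :
    Set (ProbabilityMeasure (PolicyProfile O A)) :=
  Set.range fun ν : ProbabilityMeasure (pureProfiles O A) =>
    ν.map (f := Subtype.val) measurable_subtype_coe.aemeasurable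

end

end

end DecTeam

namespace DecTeam

noncomputable section

variable {N : ℕ} {S : Type*} [MeasurableSpace S]
  {O : Fin (N + 1) → Type*} [∀ i, MeasurableSpace (O i)]
  [∀ i, Countable (O i)] [∀ i, MeasurableSingletonClass (O i)]
  {A : Fin N → Type*} [∀ n, Finite (A n)]
  [∀ n, TopologicalSpace (A n)] [∀ n, DiscreteTopology (A n)]
  [∀ n, MeasurableSpace (A n)] [∀ n, BorelSpace (A n)]

/-! Fix a path of joint observations and actions up to time `t`. Its probability under a profile `u`
is `w(u) * c`. Here `w(u)` is the product, over times `i ≤ t` and agents `n`, of the probabilities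
that `u` gives to the prescribed actions. The factor `c` comes from the initial law and the
transitions, hence does not depend on `u` (`exists_profileLaw_agreeUpTo_inter`). Each entry of the
occupation measure of `μ` is therefore `c * ∫ w dμ`, and only the integrals of such weights matter.

The factors of `w` sit at distinct decision points, since each pair of a time and an agent occurs
once. Draw an action independently at every decision point according to `u`. The weight of the
resulting pure profile is the indicator that the draws match the path, and by independence its
expectation is `w(u)` (`lintegral_planKernel_policyWeight`). Drawing `u` from `μ` first gives a
mixture of pure profiles with the same integrals as `μ` (`lintegral_purification`). -/

/-! ### Paths and their policy weights. -/

/-- The joint history at time `t` along a sequence of joint observations and joint actions. -/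
def seqHist (o : ℕ → JointObs O) (a : ℕ → JointAct A) (t : ℕ) : JointHist O A t :=
  (fun i => o i, fun i => a i)

/-- The trajectories that agree up to time `t` with given joint observations and actions. -/
def agreeUpTo (S : Type*) (o : ℕ → JointObs O) (a : ℕ → JointAct A) (t : ℕ) :
    Set (ℕ → Step S O A) :=
  {ω | ∀ i ≤ t, (ω i).1.2 = o i ∧ (ω i).2 = a i}

/-- The factor that the policy-profile contributes to the probability of a path up to time `t`. -/
def policyWeight (o : ℕ → JointObs O) (a : ℕ → JointAct A) (t : ℕ) (u : PolicyProfile O A) :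
    ENNReal :=
  ∏ i ∈ Finset.range (t + 1), jointActLaw u (seqHist o a i) {a i}

omit [∀ i, MeasurableSpace (O i)] [∀ i, Countable (O i)]
  [∀ i, MeasurableSingletonClass (O i)] in
lemma policyWeight_eq_prod (o : ℕ → JointObs O) (a : ℕ → JointAct A) (t : ℕ)
    (u : PolicyProfile O A) :
    policyWeight o a t u = ∏ p ∈ Finset.range (t + 1) ×ˢ Finset.univ,
      (u p.2 p.1 (agentHist (seqHist o a p.1) p.2) : Measure (A p.2)) {a p.1 p.2} := by
  rw [Finset.prod_product]
  refine Finset.prod_congr rfl fun i _ => ?_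
  rw [jointActLaw, Measure.pi_singleton]

lemma measurable_policyWeight (o : ℕ → JointObs O) (a : ℕ → JointAct A) (t : ℕ) :
    Measurable (policyWeight o a t) := by
  simp only [funext (policyWeight_eq_prod o a t)]
  exact Finset.measurable_prod _ fun p _ => measurable_profile_apply _ _ _ _

omit [∀ i, Countable (O i)] in
lemma measurableSet_agreeUpTo (o : ℕ → JointObs O) (a : ℕ → JointAct A) (t : ℕ) :
    MeasurableSet (agreeUpTo S o a t) := by
  have : agreeUpTo S o a t = ⋂ i, ⋂ _ : i ≤ t, {ω : ℕ → Step S O A | (ω i).1.2 ∈ ({o i} : Set _)} ∩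
      {ω : ℕ → Step S O A | (ω i).2 ∈ ({a i} : Set _)} := by
    ext ω
    simp [agreeUpTo]
  rw [this]
  exact .iInter fun i => .iInter fun _ =>
    ((measurable_pi_apply i).fst.snd (measurableSet_singleton (o i))).inter
      ((measurable_pi_apply i).snd (measurableSet_singleton (a i)))

/-! ### Factorization of path probabilities. -/

lemma initKernel_apply_prod (P₁ : Measure (S × JointObs O)) [IsProbabilityMeasure P₁]
    (u : PolicyProfile O A) (o : ℕ → JointObs O) (a : ℕ → JointAct A) {B : Set S}
    (hB : MeasurableSet B) :
    initKernel P₁ u ((B ×ˢ {o 0}) ×ˢ {a 0}) = policyWeight o a 0 u * P₁ (B ×ˢ {o 0}) := by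
  have hC : MeasurableSet (B ×ˢ ({o 0} : Set (JointObs O))) := hB.prod (measurableSet_singleton _)
  rw [initKernel, Kernel.compProd_apply_prod hC (measurableSet_singleton _),
    setLIntegral_congr_fun (g := fun _ => policyWeight o a 0 u) hC, setLIntegral_const,
    Kernel.const_apply]
  rintro ⟨s, o'⟩ ⟨-, rfl : o' = o 0⟩
  rw [policyWeight, Finset.prod_range_one]
  change jointActLaw u (fun _ => o 0, Fin.elim0) {a 0} = _
  congr 2
  refine Prod.ext (funext fun i => ?_) (funext fun i => i.elim0)
  simp [seqHist]

-- This makes the action law at time `t + 1` constant on the event that the path is followed, so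
-- that it can be pulled out of integrals.
omit [∀ i, MeasurableSpace (O i)] [∀ i, Countable (O i)] [∀ i, MeasurableSingletonClass (O i)]
  [∀ n, Finite (A n)] [∀ n, TopologicalSpace (A n)] [∀ n, DiscreteTopology (A n)]
  [∀ n, MeasurableSpace (A n)] [∀ n, BorelSpace (A n)] [MeasurableSpace S] in
lemma nextHist_eq_seqHist {o : ℕ → JointObs O} {a : ℕ → JointAct A} {t : ℕ}
    {x : Finset.Iic t → Step S O A} (hx : ∀ i, (x i).1.2 = o i ∧ (x i).2 = a i) :
    nextHist t x (o (t + 1)) = seqHist o a (t + 1) := by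
  refine Prod.ext (funext fun i => ?_) (funext fun i => (hx _).2)
  induction i using Fin.lastCases with
  | last => simp [nextHist, seqHist]
  | cast j => simpa [nextHist, seqHist] using (hx _).1

lemma stepKernel_apply_prod (Ptr : Kernel (S × JointAct A) (S × JointObs O)) [IsMarkovKernel Ptr]
    (u : PolicyProfile O A) {o : ℕ → JointObs O} {a : ℕ → JointAct A} {t : ℕ}
    {x : Finset.Iic t → Step S O A} (hx : ∀ i, (x i).1.2 = o i ∧ (x i).2 = a i) {B : Set S}
    (hB : MeasurableSet B) :
    stepKernel Ptr t (u, x) ((B ×ˢ {o (t + 1)}) ×ˢ {a (t + 1)}) =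
      jointActLaw u (seqHist o a (t + 1)) {a (t + 1)} *
        Ptr ((x ⟨t, Finset.mem_Iic.2 le_rfl⟩).1.1, a t) (B ×ˢ {o (t + 1)}) := by
  have hC : MeasurableSet (B ×ˢ ({o (t + 1)} : Set (JointObs O))) :=
    hB.prod (measurableSet_singleton _)
  rw [stepKernel, Kernel.compProd_apply_prod hC (measurableSet_singleton _),
    setLIntegral_congr_fun (g := fun _ => jointActLaw u (seqHist o a (t + 1)) {a (t + 1)}) hC,
    setLIntegral_const, Kernel.comap_apply]
  · simp only [(hx ⟨t, Finset.mem_Iic.2 le_rfl⟩).2]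
  · rintro ⟨s, o'⟩ ⟨-, rfl : o' = o (t + 1)⟩
    change jointActLaw u (nextHist t x (o (t + 1))) {a (t + 1)} = _
    rw [nextHist_eq_seqHist hx]

lemma profileLaw_map_zero (Ptr : Kernel (S × JointAct A) (S × JointObs O)) [IsMarkovKernel Ptr]
    (P₁ : Measure (S × JointObs O)) [IsProbabilityMeasure P₁] (u : PolicyProfile O A) :
    (profileLaw Ptr P₁ u).map (fun ω => ω 0) = initKernel P₁ u := by
  have h : (profileLaw Ptr P₁ u).map (Preorder.frestrictLe (π := fun _ => Step S O A) 0) =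
      (initKernel P₁ u).map
        (MeasurableEquiv.piUnique (fun _ : Finset.Iic 0 => Step S O A)).symm := by
    rw [profileLaw, Kernel.trajMeasure, Measure.map_comp _ _ (by fun_prop),
      Kernel.traj_map_frestrictLe, Kernel.partialTraj_self, Measure.id_comp]
  have h2 := congrArg
    (fun m => m.map (MeasurableEquiv.piUnique fun _ : Finset.Iic 0 => Step S O A)) h
  simp only [MeasurableEquiv.map_map_symm] at h2
  rw [← h2, Measure.map_map (MeasurableEquiv.measurable _) (by fun_prop)]
  rfl

/-- Along a given path of joint observations and actions, the law of the current state is a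
measure that does not depend on the policy-profile, up to the factor `policyWeight`. -/
lemma exists_profileLaw_agreeUpTo_inter (Ptr : Kernel (S × JointAct A) (S × JointObs O))
    [IsMarkovKernel Ptr] (P₁ : Measure (S × JointObs O)) [IsProbabilityMeasure P₁]
    (o : ℕ → JointObs O) (a : ℕ → JointAct A) (t : ℕ) :
    ∃ c : Measure S, ∀ (u : PolicyProfile O A) (B : Set S), MeasurableSet B →
      profileLaw Ptr P₁ u (agreeUpTo S o a t ∩ {ω | (ω t).1.1 ∈ B}) =
        policyWeight o a t u * c B := by
  induction t with
  | zero =>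
    -- The unnormalized law of the initial state on the event that the first observation is `o 0`.
    refine ⟨(P₁.restrict (Set.univ ×ˢ {o 0})).map Prod.fst, fun u B hB => ?_⟩
    rw [Measure.map_apply measurable_fst hB, Measure.restrict_apply (measurable_fst hB),
      show (Prod.fst ⁻¹' B ∩ Set.univ ×ˢ {o 0} : Set (S × JointObs O)) = B ×ˢ {o 0} by
        ext; simp, ← initKernel_apply_prod P₁ u o a hB, ← profileLaw_map_zero Ptr P₁ u,
      Measure.map_apply (measurable_pi_apply (0 : ℕ))
        ((hB.prod (measurableSet_singleton _)).prod (measurableSet_singleton _))]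
    congr 1
    ext ω
    simp only [agreeUpTo, nonpos_iff_eq_zero, forall_eq, Set.mem_inter_iff, Set.mem_ofPred_eq,
      Set.mem_preimage, Set.mem_prod, Set.mem_singleton_iff]
    tauto
  | succ t ih =>
    obtain ⟨c, hc⟩ := ih
    -- On the path the action at time `t` is `a t`, so the transition is a kernel in the state
    -- alone. The new `c` pushes the old one through it and keeps the mass at the observation `o (t
    -- + 1)`.
    let κ : Kernel S (S × JointObs O) := Ptr.comap (fun s => (s, a t)) (by fun_prop)
    refine ⟨((c.bind κ).restrict (Set.univ ×ˢ {o (t + 1)})).map Prod.fst, fun u B hB => ?_⟩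
    have hC : MeasurableSet (B ×ˢ ({o (t + 1)} : Set (JointObs O))) :=
      hB.prod (measurableSet_singleton _)
    -- The induction hypothesis as an equality of measures on the state. The transition integrates
    -- against this state law, which is why the induction carries a set `B` of states.
    have hm : ((profileLaw Ptr P₁ u).restrict (agreeUpTo S o a t)).map (fun ω => (ω t).1.1) =
        policyWeight o a t u • c := by
      ext B' hB'
      rw [Measure.map_apply (by fun_prop) hB', Measure.restrict_apply
        ((measurable_pi_apply t).fst.fst hB'), Measure.smul_apply, smul_eq_mul, ← hc u B' hB',
        Set.inter_comm]
      rfl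
    let G : Set (Finset.Iic t → Step S O A) := {x | ∀ i, (x i).1.2 = o i ∧ (x i).2 = a i}
    have hG : MeasurableSet G := by
      have : G = ⋂ i : Finset.Iic t,
          {x | (x i).1.2 ∈ ({o i} : Set _)} ∩ {x | (x i).2 ∈ ({a i} : Set _)} := by
        ext; simp [G]
      rw [this]
      exact .iInter fun i => ((measurable_pi_apply i).fst.snd (measurableSet_singleton _)).inter
        ((measurable_pi_apply i).snd (measurableSet_singleton _))
    have hGpre : Preorder.frestrictLe (π := fun _ => Step S O A) t ⁻¹' G = agreeUpTo S o a t := by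
      ext ω
      simp [G, agreeUpTo]
    -- A rectangle in the pair (past, next step), on which the defining disintegration of the
    -- trajectory law applies.
    have hpre : agreeUpTo S o a (t + 1) ∩ {ω | (ω (t + 1)).1.1 ∈ B} =
        (fun ω => (Preorder.frestrictLe (π := fun _ => Step S O A) t ω, ω (t + 1))) ⁻¹'
          (G ×ˢ ((B ×ˢ {o (t + 1)}) ×ˢ {a (t + 1)})) := by
      rw [Set.mk_preimage_prod, hGpre]
      ext ω
      simp only [agreeUpTo, Nat.le_succ_iff, or_imp, forall_and, forall_eq,
        Set.mem_inter_iff, Set.mem_ofPred_eq, Set.mem_preimage, Set.mem_prod,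
        Set.mem_singleton_iff]
      tauto
    have hstep := Kernel.map_frestrictLe_trajMeasure_compProd_eq_map_trajMeasure
      (X := fun _ => Step S O A) (μ₀ := initKernel P₁ u)
      (κ := fun t => (stepKernel Ptr t).sectR u) (a := t)
    have hmeas := Ptr.measurable_coe hC
    rw [hpre, ← Measure.map_apply (by fun_prop) (hG.prod (hC.prod (measurableSet_singleton _))),
      profileLaw, ← hstep, ← profileLaw,
      Measure.compProd_apply_prod hG (hC.prod (measurableSet_singleton _))]
    simp only [Kernel.sectR_apply]
    rw [setLIntegral_congr_fun hG fun x hx => stepKernel_apply_prod Ptr u hx hB,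
      setLIntegral_map hG (by fun_prop) (by fun_prop), hGpre, lintegral_const_mul _ (by fun_prop),
      Measure.map_apply measurable_fst hB, Measure.restrict_apply (measurable_fst hB),
      show (Prod.fst ⁻¹' B ∩ Set.univ ×ˢ {o (t + 1)} : Set (S × JointObs O)) =
        B ×ˢ {o (t + 1)} by ext; simp, Measure.bind_apply hC κ.measurable.aemeasurable,
      policyWeight, Finset.prod_range_succ, ← policyWeight, mul_comm (policyWeight o a t u),
      mul_assoc, ← smul_eq_mul (policyWeight o a t u), ← lintegral_smul_measure, ← hm,
      lintegral_map (κ.measurable_coe hC) (by fun_prop)]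
    rfl

/-! ### Independent draws of pure plans. -/

/-- The decision points of the agents: an agent, a time and a history of that agent. -/
abbrev DecisionPoint (O : Fin (N + 1) → Type*) (A : Fin N → Type*) :=
  Σ n : Fin N, Σ t : ℕ, AgentHist O A n t

/-- Deterministic choices of an action at every decision point. -/
abbrev ActionPlan (O : Fin (N + 1) → Type*) (A : Fin N → Type*) :=
  ∀ p : DecisionPoint O A, A p.1

/-- The pure policy-profile that follows a deterministic plan. -/
def ActionPlan.toProfile (f : ActionPlan O A) : PolicyProfile O A :=
  fun n t h => diracProba (f ⟨n, t, h⟩)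

omit [∀ i, MeasurableSpace (O i)] [∀ i, Countable (O i)]
  [∀ i, MeasurableSingletonClass (O i)] in
lemma ActionPlan.toProfile_apply_singleton (f : ActionPlan O A) (n : Fin N) (t : ℕ)
    (h : AgentHist O A n t) (a : A n) :
    (f.toProfile n t h : Measure (A n)) {a} = ({a} : Set (A n)).indicator 1 (f ⟨n, t, h⟩) :=
  diracProba_toMeasure_apply' _ (measurableSet_singleton a)

/-- `ActionPlan.toProfile`, with values in the subspace of pure policy-profiles. -/
def ActionPlan.toPureProfile (f : ActionPlan O A) : pureProfiles O A :=
  ⟨f.toProfile, fun n t h => ⟨f ⟨n, t, h⟩, rfl⟩⟩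

-- There are only countably many decision points, so open sets of plans are measurable for the
-- product σ-algebra and continuity suffices.
omit [∀ i, MeasurableSpace (O i)] [∀ i, MeasurableSingletonClass (O i)] in
lemma ActionPlan.measurable_toProfile :
    Measurable (ActionPlan.toProfile : ActionPlan O A → PolicyProfile O A) := by
  refine Continuous.measurable ?_
  refine continuous_pi fun n => continuous_pi fun t => continuous_pi fun h => ?_
  exact continuous_diracProba.comp (continuous_apply _)

omit [∀ i, MeasurableSpace (O i)] [∀ i, MeasurableSingletonClass (O i)] in
lemma ActionPlan.measurable_toPureProfile :
    Measurable (ActionPlan.toPureProfile : ActionPlan O A → pureProfiles O A) :=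
  ActionPlan.measurable_toProfile.subtype_mk

/-- Independent draws of an action at every decision point according to a policy-profile. -/
def planKernel (O : Fin (N + 1) → Type*) [∀ i, MeasurableSpace (O i)]
    [∀ i, Countable (O i)] [∀ i, MeasurableSingletonClass (O i)]
    (A : Fin N → Type*) [∀ n, Finite (A n)]
    [∀ n, TopologicalSpace (A n)] [∀ n, DiscreteTopology (A n)]
    [∀ n, MeasurableSpace (A n)] [∀ n, BorelSpace (A n)] :
    Kernel (PolicyProfile O A) (ActionPlan O A) where
  toFun u := Measure.infinitePi fun p : DecisionPoint O A => (u p.1 p.2.1 p.2.2 : Measure (A p.1))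
  measurable' := by
    refine Measurable.measure_of_isPiSystem_of_isProbabilityMeasure
      (generateFrom_squareCylinders (α := fun p : DecisionPoint O A => A p.1)).symm
      (isPiSystem_squareCylinders (fun _ => MeasurableSpace.isPiSystem_measurableSet) (by simp)) ?_
    rintro _ ⟨s, B, hB, rfl⟩
    have hB' : ∀ p ∈ s, MeasurableSet (B p) := fun p _ => hB p (Set.mem_univ p)
    simp only [Measure.infinitePi_pi _ hB']
    exact Finset.measurable_prod _ fun p _ => measurable_profile_apply _ _ _ _

instance : IsMarkovKernel (planKernel O A) :=
  ⟨fun u => inferInstanceAs (IsProbabilityMeasure (Measure.infinitePi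
    fun p : DecisionPoint O A => (u p.1 p.2.1 p.2.2 : Measure (A p.1))))⟩

/-- The pure policy-profile of a plan drawn independently at all decision points gives every path
the same expected weight as the policy-profile that generates the draws. -/
lemma lintegral_planKernel_policyWeight (o : ℕ → JointObs O) (a : ℕ → JointAct A) (t : ℕ)
    (u : PolicyProfile O A) :
    ∫⁻ f, policyWeight o a t f.toProfile ∂planKernel O A u = policyWeight o a t u := by
  classical
  -- A decision point records its agent and its time, so no decision point is visited twice along a
  -- path. Independence of the draws applies because of this.
  let e : ℕ × Fin N ↪ DecisionPoint O A :=
    ⟨fun p => ⟨p.2, p.1, agentHist (seqHist o a p.1) p.2⟩, by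
      rintro ⟨i, n⟩ ⟨j, m⟩ h
      obtain ⟨rfl, h⟩ := Sigma.mk.inj_iff.1 h
      obtain ⟨rfl, -⟩ := Sigma.mk.inj_iff.1 (eq_of_heq h)
      rfl⟩
  let I : Finset (DecisionPoint O A) := (Finset.range (t + 1) ×ˢ Finset.univ).map e
  let B : ∀ p : DecisionPoint O A, Set (A p.1) := fun p => {a p.2.1 p.1}
  have hB : ∀ p, MeasurableSet (B p) := fun p => measurableSet_singleton _
  -- For a plan every factor is 0 or 1, so the weight is the indicator of a finite-dimensional box.
  have hf (f : ActionPlan O A) :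
      policyWeight o a t f.toProfile = (Set.pi (I : Set (DecisionPoint O A)) B).indicator 1 f := by
    simp only [policyWeight_eq_prod, ActionPlan.toProfile_apply_singleton, Set.indicator_apply,
      Pi.one_apply]
    rw [Finset.prod_ite_zero, Finset.prod_const_one]
    refine if_congr ?_ rfl rfl
    simp only [I, B, Set.mem_pi, Finset.mem_coe, Finset.mem_map, forall_exists_index, and_imp,
      forall_apply_eq_imp_iff₂]
    rfl
  simp only [hf]
  rw [lintegral_indicator_one (.pi I.countable_toSet fun p _ => hB p), policyWeight_eq_prod]
  change Measure.infinitePi _ _ = _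
  rw [Measure.infinitePi_pi _ fun p _ => hB p, Finset.prod_map]
  rfl

/-- The joint mixture of pure policy-profiles obtained by drawing a policy-profile from `μ` and
then drawing its actions independently at all decision points. -/
def purification (μ : ProbabilityMeasure (PolicyProfile O A)) :
    ProbabilityMeasure (pureProfiles O A) :=
  ⟨((μ : Measure (PolicyProfile O A)).bind (planKernel O A)).map
      ActionPlan.toPureProfile,
    Measure.isProbabilityMeasure_map ActionPlan.measurable_toPureProfile.aemeasurable⟩

lemma lintegral_purification (μ : ProbabilityMeasure (PolicyProfile O A))
    (o : ℕ → JointObs O) (a : ℕ → JointAct A) (t : ℕ) :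
    ∫⁻ v, policyWeight o a t v ∂((purification μ).map (f := Subtype.val)
        measurable_subtype_coe.aemeasurable : Measure (PolicyProfile O A)) =
      ∫⁻ u, policyWeight o a t u ∂(μ : Measure (PolicyProfile O A)) := by
  have hw := measurable_policyWeight o a t
  rw [ProbabilityMeasure.toMeasure_map, lintegral_map hw measurable_subtype_coe]
  change ∫⁻ v : pureProfiles O A, policyWeight o a t v ∂Measure.map _ _ = _
  rw [lintegral_map (by exact hw.comp measurable_subtype_coe)
    ActionPlan.measurable_toPureProfile]
  change ∫⁻ f : ActionPlan O A, policyWeight o a t f.toProfile ∂_ = _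
  rw [Measure.lintegral_bind
    (planKernel O A).aemeasurable (by exact (hw.comp ActionPlan.measurable_toProfile).aemeasurable)]
  simp only [lintegral_planKernel_policyWeight]

/-! ### Comparison of occupation measures. -/

lemma mixtureLaw_agreeUpTo (Ptr : Kernel (S × JointAct A) (S × JointObs O)) [IsMarkovKernel Ptr]
    (P₁ : Measure (S × JointObs O)) [IsProbabilityMeasure P₁]
    (μ : ProbabilityMeasure (PolicyProfile O A))
    (o : ℕ → JointObs O) (a : ℕ → JointAct A) (t : ℕ) :
    mixtureLaw Ptr P₁ μ (Prod.snd ⁻¹' agreeUpTo S o a t) =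
      ∫⁻ u, profileLaw Ptr P₁ u (agreeUpTo S o a t) ∂(μ : Measure (PolicyProfile O A)) := by
  have : IsMarkovKernel (profileKernel (A := A) Ptr P₁) :=
    ⟨fun u => inferInstanceAs (IsProbabilityMeasure (profileLaw Ptr P₁ u))⟩
  rw [mixtureLaw, Measure.compProd_apply (measurable_snd (measurableSet_agreeUpTo o a t))]
  rfl

omit [∀ i, MeasurableSpace (O i)] [∀ i, Countable (O i)] [∀ i, MeasurableSingletonClass (O i)]
  [∀ n, Finite (A n)] [∀ n, TopologicalSpace (A n)] [∀ n, DiscreteTopology (A n)]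
  [∀ n, MeasurableSpace (A n)] [∀ n, BorelSpace (A n)] in
lemma exists_setOf_trajHist_eq_agreeUpTo (S : Type*) {t : ℕ} (h : JointHist O A t)
    (a : JointAct A) :
    ∃ (o : ℕ → JointObs O) (a' : ℕ → JointAct A),
      {ω : ℕ → Step S O A | trajHist t ω = h ∧ (ω t).2 = a} = agreeUpTo S o a' t := by
  -- The history has actions only before `t`, so the default `a` is the required action at time `t`.
  -- All values after `t` are irrelevant.
  refine ⟨fun i => if hi : i < t + 1 then h.1 ⟨i, hi⟩ else h.1 0,
    fun i => if hi : i < t then h.2 ⟨i, hi⟩ else a, ?_⟩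
  ext ω
  constructor
  · rintro ⟨rfl, rfl⟩ i hi
    dsimp only
    refine ⟨by rw [dif_pos (Nat.lt_succ_of_le hi)]; rfl, ?_⟩
    split_ifs with hit
    · rfl
    · rw [le_antisymm hi (not_lt.1 hit)]
  · intro H
    refine ⟨Prod.ext (funext fun i => ?_) (funext fun i => ?_), ?_⟩
    · exact (H i (Nat.lt_succ_iff.1 i.2)).1.trans (dif_pos i.2)
    · exact (H i i.2.le).2.trans (dif_pos i.2)
    · exact (H t le_rfl).2.trans (dif_neg (lt_irrefl t))

lemma occupationMeasure_purification (Ptr : Kernel (S × JointAct A) (S × JointObs O))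
    [IsMarkovKernel Ptr] (P₁ : Measure (S × JointObs O)) [IsProbabilityMeasure P₁]
    (T : ℕ∞) (α : ℝ) (μ : ProbabilityMeasure (PolicyProfile O A)) :
    occupationMeasure Ptr P₁ T α
        ((purification μ).map (f := Subtype.val) measurable_subtype_coe.aemeasurable) =
      occupationMeasure Ptr P₁ T α μ := by
  funext ⟨t, h, a⟩
  obtain ⟨o, a', hE⟩ := exists_setOf_trajHist_eq_agreeUpTo S h a
  obtain ⟨c, hc⟩ := exists_profileLaw_agreeUpTo_inter Ptr P₁ o a' t
  have hE' : {x : PolicyProfile O A × (ℕ → Step S O A) | trajHist t x.2 = h ∧ (x.2 t).2 = a} =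
      Prod.snd ⁻¹' agreeUpTo S o a' t := by
    rw [← hE]; rfl
  -- The final state is no longer needed: take all states as `B`.
  have hu (u : PolicyProfile O A) : profileLaw Ptr P₁ u (agreeUpTo S o a' t) =
      policyWeight o a' t u * c Set.univ := by
    simpa using hc u Set.univ .univ
  simp only [occupationMeasure, measureReal_def, hE', mixtureLaw_agreeUpTo, hu]
  rw [lintegral_mul_const _ (measurable_policyWeight o a' t),
    lintegral_mul_const _ (measurable_policyWeight o a' t), lintegral_purification]

end

end DecTeam

theorem mainTheorem2 {N : ℕ} {S : Type*} [TopologicalSpace S] [MeasurableSpace S] [BorelSpace S]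
    {O : Fin (N + 1) → Type*} [∀ i, Countable (O i)]
    [∀ i, MeasurableSpace (O i)] [∀ i, MeasurableSingletonClass (O i)]
    {A : Fin N → Type*} [∀ n, Finite (A n)]
    [∀ n, TopologicalSpace (A n)] [∀ n, DiscreteTopology (A n)]
    [∀ n, MeasurableSpace (A n)] [∀ n, BorelSpace (A n)]
    (Ptr : Kernel (S × DecTeam.JointAct A) (S × DecTeam.JointObs O)) [IsMarkovKernel Ptr]
    (P₁ : Measure (S × DecTeam.JointObs O)) [IsProbabilityMeasure P₁] :
    DecTeam.occupationMeasure Ptr P₁ ⊤ 1 ''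
        (Set.univ : Set (ProbabilityMeasure (DecTeam.PolicyProfile O A))) =
      DecTeam.occupationMeasure Ptr P₁ ⊤ 1 '' DecTeam.pureMixtures O A := by
  -- Pure mixtures are particular mixtures, so only purification of an arbitrary mixture remains.
  refine Set.Subset.antisymm ?_ (Set.image_mono (Set.subset_univ _))
  rintro _ ⟨μ, -, rfl⟩
  exact ⟨_, ⟨DecTeam.purification μ, rfl⟩, DecTeam.occupationMeasure_purification Ptr P₁ ⊤ 1 μ⟩
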